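/- Let $n$ and $k$ be integers with $3\le k\le n-2$. For a finite connected graph $G$, the Harary index is $H(G)=\sum_{\{u,v\}}\frac{1}{d(u,v)}$, where the sum runs over all unordered pairs of distinct vertices of $G$ and $d(u,v)$ is the distance in $G$. A pendent vertex is a vertex of degree $1$. The balanced starlike tree $BS_{n,k}$ is the tree on $n$ vertices, unique up to isomorphism, that has a vertex $v$ such that $BS_{n,k}-v$ is a disjoint union of paths with $n_1\ge n_2\ge\dots\ge n_k\ge 1$ vertices, each joined to $v$ by one of its endvertices, where $n_1+\dots+n_k=n-1$ and $|n_i-n_j|\le 1$ for all $i,j$. Then among all trees on $n$ vertices with exactly $k$ pendent vertices, $BS_{n,k}$ is, up to isomorphism, the unique tree with maximal Harary index. That is, $BS_{n,k}$ is a tree on $n$ vertices with exactly $k$ pendent vertices, and every tree $T$ on $n$ vertices with exactly $k$ pendent vertices satisfies $H(T)\le H(BS_{n,k})$, with equality if and only if $T\cong BS_{n,k}$. -/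

import Mathlib

namespace Harary

/-- The Harary index: half the sum of all entries of the reciprocal distance matrix, that is, the
sum of `1 / d(u, v)` over all unordered pairs of distinct vertices. (The diagonal entries of that
matrix are zero, and so are the terms below with `u = v`, since `(0 : ℝ)⁻¹ = 0`.) -/
noncomputable def hararyIndex {V : Type*} [Fintype V] (G : SimpleGraph V) : ℝ :=
  (∑ u : V, ∑ v : V, ((G.dist u v : ℕ) : ℝ)⁻¹) / 2

open Classical in
/-- The pendent vertices of a finite graph: the vertices of degree one. -/
noncomputable def pendentVertices {V : Type*} [Fintype V] (G : SimpleGraph V) : Finset V :=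
  Finset.univ.filter fun v => G.degree v = 1

/-- The vertices of `S(ℓ₀, …, ℓₖ₋₁)`: the branching vertex `none`, and the `j`-th vertex
`some ⟨i, j⟩` of the `i`-th path, counted from the branching vertex. -/
abbrev StarlikeVertex {k : ℕ} (ℓ : Fin k → ℕ) : Type := Option (Σ i : Fin k, Fin (ℓ i))

/-- `b` is the next vertex after `a` on a path that leaves the branching vertex. -/
def starlikeNext {k : ℕ} (ℓ : Fin k → ℕ) : StarlikeVertex ℓ → StarlikeVertex ℓ → Prop
  | none, some b => b.2.val = 0
  | some a, some b => a.1 = b.1 ∧ b.2.val = a.2.val + 1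
  | _, none => False

/-- The tree `S(ℓ₀, …, ℓₖ₋₁)`: deleting the branching vertex leaves disjoint paths with
`ℓ₀, …, ℓₖ₋₁` vertices, each joined by one of its ends to the branching vertex. -/
def starlikeTree {k : ℕ} (ℓ : Fin k → ℕ) : SimpleGraph (StarlikeVertex ℓ) :=
  SimpleGraph.fromRel (starlikeNext ℓ)

/-- The orders of the `k` paths of the balanced starlike tree on `n` vertices: the `n - 1` vertices
other than the branching vertex are distributed as evenly as possible. -/
def balancedLengths (n k : ℕ) (i : Fin k) : ℕ :=
  (n - 1) / k + if i.val < (n - 1) % k then 1 else 0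

/-- The balanced starlike tree with `k` paths on `n` vertices. -/
def balancedStarlikeTree (n k : ℕ) : SimpleGraph (StarlikeVertex (balancedLengths n k)) :=
  starlikeTree (balancedLengths n k)

/-- The path orders of the balanced starlike tree are non-increasing. -/
theorem balancedLengths_antitone (n k : ℕ) : Antitone (balancedLengths n k) := by
  intro i j h
  have h' : i.val ≤ j.val := h
  unfold balancedLengths
  split_ifs <;> omega

/-- The path orders of the balanced starlike tree pairwise differ by at most one. -/
theorem balancedLengths_le_succ (n k : ℕ) (i j : Fin k) :
    balancedLengths n k i ≤ balancedLengths n k j + 1 := by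
  unfold balancedLengths
  split_ifs <;> omega

/-- The path orders of the balanced starlike tree are positive. -/
theorem balancedLengths_pos (n k : ℕ) (h : k + 1 ≤ n) (i : Fin k) :
    1 ≤ balancedLengths n k i := by
  have hk : 0 < k := i.pos
  have : 1 ≤ (n - 1) / k := (Nat.one_le_div_iff hk).2 (by omega)
  unfold balancedLengths
  omega

/-- The path orders of the balanced starlike tree sum to the number of vertices minus one. -/
theorem balancedLengths_sum (n k : ℕ) (hk : 0 < k) (hn : 1 ≤ n) :
    ∑ i, balancedLengths n k i + 1 = n := by
  have hlt : (n - 1) % k < k := Nat.mod_lt _ hk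
  have h1 : ∑ i : Fin k, (if i.val < (n - 1) % k then 1 else 0) = (n - 1) % k := by
    rw [Fin.sum_univ_eq_sum_range (fun i => if i < (n - 1) % k then 1 else 0) k,
      ← Finset.card_filter]
    have : (Finset.range k).filter (fun i => i < (n - 1) % k) = Finset.range ((n - 1) % k) := by
      ext x
      simp only [Finset.mem_filter, Finset.mem_range]
      omega
    rw [this, Finset.card_range]
  have h2 := Nat.div_add_mod (n - 1) k
  simp only [balancedLengths, Finset.sum_add_distrib, h1, Finset.sum_const, Finset.card_univ,
    Fintype.card_fin, smul_eq_mul]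
  omega

end Harary

/-! The tree is grown from its pendent vertices. Let `S` be a convex set spanned by `j` vertices
`X`, and attach the shortest path from `S` to a further vertex `x`, with gate `g ∈ S` and `h` new
vertices. Every shortest path from `S` to a new vertex passes through `g`, so the gain depends only
on the distances from `g`. A sphere about `g` in `S` has at most `j` points, because they lie on the
ways to different vertices in `X`. The sorted distances are therefore at least `1` (`j` times), `2`
(`j` times), and so on, which are the depths in the balanced starlike tree with `j` paths
(`SpannedBy.card_sphere_le`, `sum_le_sum_range_div`). So the new sum is at most that of the balanced
tree with a path of `h` vertices attached (`exists_extension`).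

Moving an end vertex from a path to one shorter by at least two keeps its distances to the rest of
these two paths and the centre as a multiset, and brings it closer to every other path. Balancing
thus never lowers the sum (`starlikeSum_le_of_le_succ`), and induction on the pendent vertices gives
the bound.

Equality in the last step forces nearly equal, hence nonempty, paths (`le_succ_of_starlikeSum_eq`),
and then a full sphere of radius one about `g`. So `g` separates the pendent vertices and the tree
is starlike; equality in the balancing makes it balanced. -/

namespace Harary

/-! ### Reciprocal distance sums of starlike trees -/

/-- The partial sums of the harmonic series, as real numbers. -/
noncomputable def harmonicSum (m : ℕ) : ℝ := ∑ t ∈ Finset.range m, ((t : ℝ) + 1)⁻¹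

/-- The sum of the reciprocal distances over the ordered pairs of vertices of a path with `m`
edges. -/
noncomputable def pathSum (m : ℕ) : ℝ := 2 * ∑ s ∈ Finset.range m, harmonicSum (s + 1)

/-- The sum of the reciprocal distances between the vertices of two paths with `p` and `q` vertices
that leave the same vertex. -/
noncomputable def crossSum (p q : ℕ) : ℝ :=
  ∑ a ∈ Finset.range p, ∑ b ∈ Finset.range q, ((a : ℝ) + b + 2)⁻¹

/-- The sum of the reciprocal distances over the ordered pairs of vertices of a starlike tree,
see `two_mul_hararyIndex_starlikeTree`. -/
noncomputable def starlikeSum {k : ℕ} (ℓ : Fin k → ℕ) : ℝ :=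
  ∑ i, (pathSum (ℓ i) - crossSum (ℓ i) (ℓ i)) + ∑ i, ∑ j, crossSum (ℓ i) (ℓ j)

theorem harmonicSum_add (m q : ℕ) :
    harmonicSum (m + q) = harmonicSum m + ∑ b ∈ Finset.range q, ((m : ℝ) + b + 1)⁻¹ := by
  simp [harmonicSum, Finset.sum_range_add]

theorem pathSum_succ (m : ℕ) : pathSum (m + 1) = pathSum m + 2 * harmonicSum (m + 1) := by
  simp [pathSum, Finset.sum_range_succ, mul_add]

theorem crossSum_comm (p q : ℕ) : crossSum p q = crossSum q p := by
  unfold crossSum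
  rw [Finset.sum_comm]
  simp only [add_comm]

theorem crossSum_succ_left (p q : ℕ) :
    crossSum (p + 1) q = crossSum p q + ∑ b ∈ Finset.range q, ((p : ℝ) + b + 2)⁻¹ := by
  simp [crossSum, Finset.sum_range_succ]

theorem sum_reciprocal_eq (p q : ℕ) :
    ∑ b ∈ Finset.range q, ((p : ℝ) + b + 2)⁻¹ = harmonicSum (p + q + 1) - harmonicSum (p + 1) := by
  have h := harmonicSum_add (p + 1) q
  rw [show p + 1 + q = p + q + 1 by ring] at h
  rw [h, add_sub_cancel_left]
  refine Finset.sum_congr rfl fun b _ => ?_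
  congr 1
  push_cast
  ring

/-! ### Balancing the paths -/

/-- The part of `starlikeSum ℓ` in which the `i`-th path does not occur. -/
noncomputable def starlikeRest {k : ℕ} (ℓ : Fin k → ℕ) (i : Fin k) : ℝ :=
  ∑ r ∈ Finset.univ.erase i, (pathSum (ℓ r) - crossSum (ℓ r) (ℓ r)) +
    ∑ r ∈ Finset.univ.erase i, ∑ s ∈ Finset.univ.erase i, crossSum (ℓ r) (ℓ s)

theorem starlikeSum_split {k : ℕ} (ℓ : Fin k → ℕ) (i : Fin k) :
    starlikeSum ℓ = pathSum (ℓ i) + 2 * ∑ r ∈ Finset.univ.erase i, crossSum (ℓ i) (ℓ r) +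
      starlikeRest ℓ i := by
  unfold starlikeSum starlikeRest
  have hi := Finset.mem_univ i
  rw [← Finset.add_sum_erase _ _ hi, ← Finset.add_sum_erase _ (fun i => ∑ j, _) hi]
  simp only [← Finset.add_sum_erase _ (fun j => crossSum _ (ℓ j)) hi, Finset.sum_add_distrib]
  have : ∑ r ∈ Finset.univ.erase i, crossSum (ℓ r) (ℓ i)
      = ∑ r ∈ Finset.univ.erase i, crossSum (ℓ i) (ℓ r) :=
    Finset.sum_congr rfl fun r _ => crossSum_comm _ _
  rw [this]
  ring

theorem starlikeRest_congr {k : ℕ} {ℓ m : Fin k → ℕ} {i : Fin k} (h : ∀ r, r ≠ i → ℓ r = m r) :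
    starlikeRest ℓ i = starlikeRest m i := by
  unfold starlikeRest
  congr 1
  · exact Finset.sum_congr rfl fun r hr => by rw [h r (Finset.ne_of_mem_erase hr)]
  · exact Finset.sum_congr rfl fun r hr => Finset.sum_congr rfl fun s hs => by
      rw [h r (Finset.ne_of_mem_erase hr), h s (Finset.ne_of_mem_erase hs)]

/-- Prolonging the `i`-th path by one vertex. -/
theorem starlikeSum_update_succ {k : ℕ} (m : Fin k → ℕ) (i : Fin k) :
    starlikeSum (Function.update m i (m i + 1)) = starlikeSum m + 2 * harmonicSum (m i + 1) +
      2 * ∑ r ∈ Finset.univ.erase i, ∑ b ∈ Finset.range (m r), ((m i : ℝ) + b + 2)⁻¹ := by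
  rw [starlikeSum_split _ i, starlikeSum_split m i,
    starlikeRest_congr (m := m) fun r hr => Function.update_of_ne hr _ _]
  have : ∑ r ∈ Finset.univ.erase i, crossSum (Function.update m i (m i + 1) i)
      (Function.update m i (m i + 1) r) = ∑ r ∈ Finset.univ.erase i, (crossSum (m i) (m r) +
        ∑ b ∈ Finset.range (m r), ((m i : ℝ) + b + 2)⁻¹) :=
    Finset.sum_congr rfl fun r hr => by
      rw [Function.update_self, Function.update_of_ne (Finset.ne_of_mem_erase hr),
        crossSum_succ_left]
  rw [this, Function.update_self, pathSum_succ, Finset.sum_add_distrib]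
  ring

/-- In either position the new vertex is an end of a path formed with the `i`-th path, the `j`-th
path and the branching vertex, so these contribute equally. Only the other paths see a difference,
and they are closer to the end of the shorter path. -/
theorem starlikeSum_update_succ_le {k : ℕ} (m : Fin k → ℕ) {i j : Fin k} (hij : i ≠ j)
    (h : m j < m i) :
    starlikeSum (Function.update m i (m i + 1)) ≤ starlikeSum (Function.update m j (m j + 1)) ∧
    ((∃ r, r ≠ i ∧ r ≠ j ∧ 0 < m r) → starlikeSum (Function.update m i (m i + 1)) <
      starlikeSum (Function.update m j (m j + 1))) := by
  rw [starlikeSum_update_succ, starlikeSum_update_succ]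
  have hj : j ∈ Finset.univ.erase i := by simp [hij.symm]
  have hi : i ∈ Finset.univ.erase j := by simp [hij]
  rw [← Finset.add_sum_erase _ _ hj, ← Finset.add_sum_erase _ _ hi,
    sum_reciprocal_eq, sum_reciprocal_eq, add_comm (m j) (m i), Finset.erase_right_comm (a := j)]
  have hterm : ∀ r, ∀ b ∈ Finset.range (m r), ((m i : ℝ) + b + 2)⁻¹ < ((m j : ℝ) + b + 2)⁻¹ := by
    intro r b _
    have : (m j : ℝ) < m i := by exact_mod_cast h
    gcongr
  have hle : ∀ r ∈ (Finset.univ.erase i).erase j, ∑ b ∈ Finset.range (m r), ((m i : ℝ) + b + 2)⁻¹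
      ≤ ∑ b ∈ Finset.range (m r), ((m j : ℝ) + b + 2)⁻¹ := fun r _ =>
    Finset.sum_le_sum fun b hb => (hterm r b hb).le
  constructor
  · linarith [Finset.sum_le_sum hle]
  · rintro ⟨r, hri, hrj, hr⟩
    have := Finset.sum_lt_sum hle ⟨r, by simp [hri, hrj],
      Finset.sum_lt_sum_of_nonempty (by simpa using hr.ne') (hterm r)⟩
    linarith

/-- Moving the last vertex of the `i`-th path to the end of the `j`-th path. -/
def moveVertex {k : ℕ} (ℓ : Fin k → ℕ) (i j : Fin k) : Fin k → ℕ :=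
  Function.update (Function.update ℓ i (ℓ i - 1)) j (ℓ j + 1)

theorem starlikeSum_le_moveVertex {k : ℕ} (ℓ : Fin k → ℕ) {i j : Fin k} (hij : i ≠ j)
    (h : ℓ j + 2 ≤ ℓ i) :
    starlikeSum ℓ ≤ starlikeSum (moveVertex ℓ i j) ∧
    ((∃ r, r ≠ i ∧ r ≠ j ∧ 0 < ℓ r) → starlikeSum ℓ < starlikeSum (moveVertex ℓ i j)) := by
  -- Both trees arise from the one without the moved vertex.
  have key := starlikeSum_update_succ_le (Function.update ℓ i (ℓ i - 1)) hij
    (by rw [Function.update_self, Function.update_of_ne hij.symm]; omega)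
  rw [Function.update_self, Function.update_of_ne hij.symm, Function.update_idem,
    Nat.sub_add_cancel (by omega), Function.update_eq_self] at key
  refine ⟨key.1, fun ⟨r, hri, hrj, hr⟩ => key.2 ⟨r, hri, hrj, ?_⟩⟩
  rwa [Function.update_of_ne hri]

/-- Needed for the identity (the order is kept) and for the square (the measure that makes balancing
terminate). -/
theorem moveVertex_sum_comp {k : ℕ} (ℓ : Fin k → ℕ) {i j : Fin k} (hij : i ≠ j) (f : ℕ → ℕ) :
    ∑ r, f (moveVertex ℓ i j r) + (f (ℓ i) + f (ℓ j)) =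
      ∑ r, f (ℓ r) + (f (ℓ i - 1) + f (ℓ j + 1)) := by
  have hj : j ∈ Finset.univ.erase i := by simp [hij.symm]
  have hi := Finset.mem_univ i
  rw [← Finset.add_sum_erase _ _ hi, ← Finset.add_sum_erase _ _ hj,
    ← Finset.add_sum_erase _ (fun r => f (ℓ r)) hi,
    ← Finset.add_sum_erase _ (fun r => f (ℓ r)) hj]
  have : ∑ r ∈ (Finset.univ.erase i).erase j, f (moveVertex ℓ i j r) =
      ∑ r ∈ (Finset.univ.erase i).erase j, f (ℓ r) :=
    Finset.sum_congr rfl fun r hr => by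
      simp only [Finset.mem_erase] at hr
      simp [moveVertex, hr.1, hr.2.1]
  rw [this]
  simp only [moveVertex, Function.update_self, Function.update_of_ne hij]
  ring

theorem moveVertex_sum {k : ℕ} (ℓ : Fin k → ℕ) {i j : Fin k} (hij : i ≠ j) (h : ℓ j + 2 ≤ ℓ i) :
    ∑ r, moveVertex ℓ i j r = ∑ r, ℓ r := by
  have := moveVertex_sum_comp ℓ hij id
  simp only [id] at this
  omega

theorem moveVertex_sum_sq_lt {k : ℕ} (ℓ : Fin k → ℕ) {i j : Fin k} (hij : i ≠ j)
    (h : ℓ j + 2 ≤ ℓ i) : ∑ r, moveVertex ℓ i j r ^ 2 < ∑ r, ℓ r ^ 2 := by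
  have := moveVertex_sum_comp ℓ hij (· ^ 2)
  obtain ⟨d, hd⟩ := Nat.exists_eq_add_of_le h
  rw [hd, show ℓ j + 2 + d - 1 = ℓ j + 1 + d by omega] at this
  nlinarith

theorem eq_div_or_of_le_succ {k : ℕ} {ℓ : Fin k → ℕ} (h : ∀ i j, ℓ i ≤ ℓ j + 1) (i : Fin k) :
    ℓ i = (∑ r, ℓ r) / k ∨ ℓ i = (∑ r, ℓ r) / k + 1 := by
  have hk : 0 < k := i.pos
  obtain ⟨j, -, hj⟩ := Finset.exists_min_image Finset.univ ℓ ⟨i, Finset.mem_univ i⟩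
  have h1 : k * ℓ j ≤ ∑ r, ℓ r := by
    have := Finset.sum_le_sum hj
    simpa using this
  have h2 : ∑ r, ℓ r < k * (ℓ j + 1) := by
    have := Finset.sum_lt_sum (fun r (_ : r ∈ Finset.univ) => h r j)
      ⟨j, Finset.mem_univ j, Nat.lt_succ_self (ℓ j)⟩
    simpa using this
  have : (∑ r, ℓ r) / k = ℓ j := by
    rw [Nat.div_eq_iff hk]
    constructor
    · linarith
    · rw [Nat.mul_add, mul_one] at h2
      have := mul_comm k (ℓ j)
      omega
  have := h i j
  have := hj i (Finset.mem_univ i)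
  omega

/-- All values are `q` or `q + 1` with `q` the rounded-down mean, so the sum fixes how often each
occurs. -/
theorem exists_perm_of_le_succ {k : ℕ} {ℓ m : Fin k → ℕ} (hℓ : ∀ i j, ℓ i ≤ ℓ j + 1)
    (hm : ∀ i j, m i ≤ m j + 1) (h : ∑ i, ℓ i = ∑ i, m i) :
    ∃ σ : Equiv.Perm (Fin k), ∀ i, m (σ i) = ℓ i := by
  have h1 := eq_div_or_of_le_succ hℓ
  have h2 := eq_div_or_of_le_succ hm
  rw [← h] at h2
  set q := (∑ r, ℓ r) / k
  have card_eq : ∀ {f : Fin k → ℕ}, (∀ i, f i = q ∨ f i = q + 1) →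
      k * q + Fintype.card {i // f i = q + 1} = ∑ i, f i := by
    intro f hf
    have hq : k * q = ∑ _i : Fin k, q := by simp
    rw [Fintype.card_subtype, Finset.card_filter, hq, ← Finset.sum_add_distrib]
    refine Finset.sum_congr rfl fun i _ => ?_
    rcases hf i with h | h <;> simp [h]
  have hcard : Fintype.card {i // ℓ i = q + 1} = Fintype.card {i // m i = q + 1} := by
    have := card_eq h1
    have := card_eq h2
    omega
  have hcard' := Fintype.card_compl_eq_card_compl _ _ hcard
  let e := Fintype.equivOfCardEq hcard
  let e' := Fintype.equivOfCardEq hcard'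
  refine ⟨Equiv.subtypeCongr e e', fun i => ?_⟩
  by_cases hi : ℓ i = q + 1
  · have : Equiv.subtypeCongr e e' i = e ⟨i, hi⟩ := by
      rw [Equiv.subtypeCongr, Equiv.trans_apply, Equiv.trans_apply,
        Equiv.sumCompl_symm_apply_of_pos (p := fun x => ℓ x = q + 1) hi]
      rfl
    rw [this, (e ⟨i, hi⟩).2, hi]
  · have : Equiv.subtypeCongr e e' i = e' ⟨i, hi⟩ := by
      rw [Equiv.subtypeCongr, Equiv.trans_apply, Equiv.trans_apply,
        Equiv.sumCompl_symm_apply_of_neg (p := fun x => ℓ x = q + 1) hi]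
      rfl
    rw [this]
    have h3 := (e' ⟨i, hi⟩).2
    have h4 := h2 (e' ⟨i, hi⟩ : Fin k)
    have h5 := h1 i
    omega

theorem starlikeSum_comp_perm {k : ℕ} (m : Fin k → ℕ) (σ : Equiv.Perm (Fin k)) :
    starlikeSum (fun i => m (σ i)) = starlikeSum m := by
  unfold starlikeSum
  rw [Equiv.sum_comp σ fun i => pathSum (m i) - crossSum (m i) (m i),
    ← Equiv.sum_comp σ fun i => ∑ j, crossSum (m i) (m j)]
  congr 1
  exact Finset.sum_congr rfl fun i _ => Equiv.sum_comp σ fun j => crossSum (m (σ i)) (m j)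

/-- Among the starlike trees with given order and number of paths, the balanced one has the largest
sum of reciprocal distances. -/
theorem starlikeSum_le_of_le_succ {k : ℕ} {m : Fin k → ℕ} (hm : ∀ i j, m i ≤ m j + 1)
    (ℓ : Fin k → ℕ) (h : ∑ i, ℓ i = ∑ i, m i) : starlikeSum ℓ ≤ starlikeSum m := by
  induction hN : ∑ i, ℓ i ^ 2 using Nat.strong_induction_on generalizing ℓ with
  | _ N ih =>
    by_cases hℓ : ∀ i j, ℓ i ≤ ℓ j + 1
    · obtain ⟨σ, hσ⟩ := exists_perm_of_le_succ hℓ hm h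
      rw [← starlikeSum_comp_perm m σ, funext hσ]
    · push Not at hℓ
      obtain ⟨i, j, hlt⟩ := hℓ
      have hij : i ≠ j := by rintro rfl; omega
      exact (starlikeSum_le_moveVertex ℓ hij hlt).1.trans
        (ih _ (hN ▸ moveVertex_sum_sq_lt ℓ hij hlt) _
          ((moveVertex_sum ℓ hij hlt).trans h) rfl)

theorem starlikeSum_lt_of_pos {k : ℕ} {m : Fin k → ℕ} (hm : ∀ i j, m i ≤ m j + 1)
    {ℓ : Fin k → ℕ} (h : ∑ i, ℓ i = ∑ i, m i) {i j r : Fin k} (hij : i ≠ j) (hri : r ≠ i)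
    (hrj : r ≠ j) (hlt : ℓ j + 2 ≤ ℓ i) (hr : 0 < ℓ r) : starlikeSum ℓ < starlikeSum m :=
  ((starlikeSum_le_moveVertex ℓ hij hlt).2 ⟨r, hri, hrj, hr⟩).trans_le
    (starlikeSum_le_of_le_succ hm _ ((moveVertex_sum ℓ hij hlt).trans h))

/-- If two orders differ by at least two, equality forces all other paths to be empty, since a third
nonempty path makes the move strict. An empty third path then yields another pair with a strict
move. The bound `k ≤ ∑ i, ℓ i` excludes `(2, 0, 0)`, which describes the same graph as `(1, 1, 0)`.
-/
theorem le_succ_of_starlikeSum_eq {k : ℕ} (hk : 3 ≤ k) {m : Fin k → ℕ}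
    (hm : ∀ i j, m i ≤ m j + 1) {ℓ : Fin k → ℕ} (h : ∑ i, ℓ i = ∑ i, m i) (hle : k ≤ ∑ i, ℓ i)
    (heq : starlikeSum ℓ = starlikeSum m) (i j : Fin k) : ℓ i ≤ ℓ j + 1 := by
  by_contra! hlt
  have hij : i ≠ j := by rintro rfl; omega
  obtain ⟨r, hri, hrj⟩ : ∃ r, r ≠ i ∧ r ≠ j := by
    have : ({i, j} : Finset (Fin k)).card < Fintype.card (Fin k) := by
      rw [Fintype.card_fin]
      exact Finset.card_le_two.trans_lt hk
    obtain ⟨r, -, hr⟩ := Finset.exists_mem_notMem_of_card_lt_card (t := Finset.univ) this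
    exact ⟨r, by simpa using hr⟩
  have hzero : ∀ s, s ≠ i → s ≠ j → ℓ s = 0 := by
    intro s hsi hsj
    by_contra hs
    exact (starlikeSum_lt_of_pos hm h hij hsi hsj hlt (Nat.pos_of_ne_zero hs)).ne heq
  have hr := hzero r hri hrj
  by_cases hj : ℓ j = 0
  · have hi : 3 ≤ ℓ i := by
      have : ∑ s, ℓ s = ℓ i := Finset.sum_eq_single i
        (fun s _ hs => if hsj : s = j then hsj ▸ hj else hzero s hs hsj) (by simp)
      omega
    -- Only the `i`-th path is nonempty. One move makes the `j`-th nonempty, after which a move from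
    -- `i` to `r` is strict.
    refine ((starlikeSum_le_moveVertex ℓ hij hlt).1.trans_lt (starlikeSum_lt_of_pos hm
      ((moveVertex_sum ℓ hij hlt).trans h) hri.symm hij.symm hrj.symm ?_ ?_)).ne heq
    · simp [moveVertex, hri, hrj, hij, hr]
      omega
    · simp [moveVertex]
  · exact (starlikeSum_lt_of_pos hm h hri.symm hij.symm hrj.symm (by omega)
      (Nat.pos_of_ne_zero hj)).ne heq

/-! ### Greedy comparison of distances -/

/-- In increasing order, the value with index `m` is at least `m / j + 1`, as each level holds at
most `j` elements. The induction removes a largest value. -/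
theorem sum_le_sum_range_div {α : Type*} (δ : α → ℕ) {j : ℕ} {f : ℕ → ℝ} (hf : Antitone f)
    (s : Finset α) (hpos : ∀ y ∈ s, 1 ≤ δ y)
    (hcard : ∀ d, 1 ≤ d → (s.filter fun y => δ y = d).card ≤ j) :
    ∑ y ∈ s, f (δ y) ≤ ∑ m ∈ Finset.range s.card, f (m / j + 1) ∧
    (StrictAnti f → j ≤ s.card → (s.filter fun y => δ y = 1).card < j →
      ∑ y ∈ s, f (δ y) < ∑ m ∈ Finset.range s.card, f (m / j + 1)) := by
  classical
  induction hN : s.card generalizing s with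
  | zero =>
    rw [Finset.card_eq_zero] at hN
    subst hN
    exact ⟨by simp, fun _ h1 h2 => absurd h2 (by omega)⟩
  | succ N ih =>
    obtain ⟨z, hz, hmax⟩ := Finset.exists_max_image s δ (Finset.card_pos.1 (by omega))
    have hcz : (s.erase z).card = N := by rw [Finset.card_erase_of_mem hz, hN]; rfl
    have hsub : ∀ d, ((s.erase z).filter fun y => δ y = d).card ≤
        (s.filter fun y => δ y = d).card := fun d =>
      Finset.card_le_card (Finset.filter_subset_filter _ (Finset.erase_subset _ _))
    obtain ⟨ih1, ih2⟩ := ih (s.erase z) (fun y hy => hpos y (Finset.mem_of_mem_erase hy))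
      (fun d hd => (hsub d).trans (hcard d hd)) hcz
    have hz1 := hpos z hz
    -- All elements lie on the levels `1, …, δ z`.
    have hNj : N + 1 ≤ j * δ z := by
      have h1 : s.card = ∑ d ∈ Finset.Icc 1 (δ z), (s.filter fun y => δ y = d).card :=
        Finset.card_eq_sum_card_fiberwise fun y hy => by
          simpa using ⟨hpos y hy, hmax y hy⟩
      have h2 := Finset.sum_le_card_nsmul (Finset.Icc 1 (δ z))
        (fun d => (s.filter fun y => δ y = d).card) j
        fun d hd => hcard d (Finset.mem_Icc.1 hd).1
      rw [← h1, hN] at h2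
      simpa [mul_comm] using h2
    have hj : 0 < j := Nat.pos_of_ne_zero (by rintro rfl; omega)
    have hdiv : N / j + 1 ≤ δ z := by
      have : N / j < δ z := by
        rw [Nat.div_lt_iff_lt_mul hj, mul_comm]
        omega
      omega
    rw [← Finset.add_sum_erase s _ hz, Finset.sum_range_succ, add_comm (f (δ z))]
    refine ⟨add_le_add ih1 (hf hdiv), fun hf' h1 h2 => ?_⟩
    by_cases hjN : j ≤ N
    · exact add_lt_add_of_lt_of_le (ih2 hf' hjN ((hsub 1).trans_lt h2)) (hf hdiv)
    -- Here `N + 1 = j`, so the maximum `1` would put `j` elements on level one.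
    · refine add_lt_add_of_le_of_lt ih1 (hf' ?_)
      rw [Nat.div_eq_of_lt (by omega)]
      by_contra hle
      have : s.filter (fun y => δ y = 1) = s := Finset.filter_true_of_mem fun y hy => by
        have := hpos y hy
        have := hmax y hy
        omega
      rw [this] at h2
      omega

/-- The vertices are dealt out in turn: number `N`, counted from zero, goes to path `N % j`, at
depth `N / j + 1`. -/
theorem balancedLengths_succ (N : ℕ) {j : ℕ} (hj : 0 < j) (i : Fin j) :
    balancedLengths (N + 2) j i = balancedLengths (N + 1) j i +
      if i.val = N % j then 1 else 0 := by
  unfold balancedLengths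
  have hi := i.2
  have h1 := Nat.div_add_mod N j
  have h2 := Nat.mod_lt N hj
  simp only [Nat.add_sub_cancel, show N + 2 - 1 = N + 1 by omega]
  by_cases h : N % j + 1 < j
  · have hm : (N + 1) % j = N % j + 1 := by
      rw [Nat.add_mod, Nat.mod_eq_of_lt (show 1 < j by omega), Nat.mod_eq_of_lt h]
    have hd : (N + 1) / j = N / j := by
      rw [Nat.succ_div_of_not_dvd]
      intro hdvd
      have := Nat.mod_eq_zero_of_dvd hdvd
      omega
    rw [hm, hd]
    split_ifs <;> omega
  · have hdvd : j ∣ N + 1 := ⟨N / j + 1, by rw [Nat.mul_add]; omega⟩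
    rw [Nat.mod_eq_zero_of_dvd hdvd, Nat.succ_div_of_dvd hdvd]
    split_ifs <;> omega

theorem sum_balancedLengths (f : ℕ → ℝ) {j : ℕ} (hj : 0 < j) (N : ℕ) :
    ∑ i, ∑ b ∈ Finset.range (balancedLengths (N + 1) j i), f (b + 1) =
      ∑ m ∈ Finset.range N, f (m / j + 1) := by
  induction N with
  | zero => simp [balancedLengths]
  | succ N ih =>
    rw [Finset.sum_range_succ, ← ih]
    let i₀ : Fin j := ⟨N % j, Nat.mod_lt N hj⟩
    have : ∀ i, ∑ b ∈ Finset.range (balancedLengths (N + 2) j i), f (b + 1) =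
        ∑ b ∈ Finset.range (balancedLengths (N + 1) j i), f (b + 1) +
          if i = i₀ then f (N / j + 1) else 0 := by
      intro i
      rw [balancedLengths_succ N hj]
      by_cases hi : i = i₀
      · have hv : i.val = N % j := congrArg Fin.val hi
        rw [if_pos hi, if_pos hv, Finset.sum_range_succ]
        simp [balancedLengths, hv]
      · have hv : i.val ≠ N % j := fun h => hi (Fin.ext h)
        rw [if_neg hi, if_neg hv, add_zero, add_zero]
    rw [Finset.sum_congr rfl fun i _ => this i, Finset.sum_add_distrib]
    simp

/-- Joining a path with `h` vertices to the branching vertex. -/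
theorem starlikeSum_cons {k : ℕ} (h : ℕ) (ℓ : Fin k → ℕ) :
    starlikeSum (Fin.cons h ℓ : Fin (k + 1) → ℕ) =
      pathSum h + 2 * ∑ i, crossSum h (ℓ i) + starlikeSum ℓ := by
  unfold starlikeSum
  simp only [Fin.sum_univ_succ, Fin.cons_zero, Fin.cons_succ, Finset.sum_add_distrib,
    crossSum_comm _ h]
  ring

theorem sum_inv_natDist (m : ℕ) :
    ∑ i ∈ Finset.range (m + 1), ∑ j ∈ Finset.range (m + 1), ((Nat.dist i j : ℕ) : ℝ)⁻¹ =
      pathSum m := by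
  induction m with
  | zero => simp [pathSum, Nat.dist]
  | succ m ih =>
    have hlast : ∑ i ∈ Finset.range (m + 1), ((Nat.dist i (m + 1) : ℕ) : ℝ)⁻¹ =
        harmonicSum (m + 1) := by
      rw [harmonicSum, ← Finset.sum_range_reflect]
      refine Finset.sum_congr rfl fun i hi => ?_
      rw [Finset.mem_range] at hi
      congr 1
      norm_cast
      rw [Nat.dist]
      omega
    rw [Finset.sum_range_succ, Finset.sum_congr rfl fun i _ => Finset.sum_range_succ _ (m + 1),
      Finset.sum_add_distrib, ih, hlast, Finset.sum_range_succ,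
      Finset.sum_congr rfl fun i _ => by rw [Nat.dist_comm], hlast, pathSum_succ]
    simp
    ring

/-! ### Starlike trees: distances, tree property, Harary index -/

/-- A criterion for a function to be the distance of a connected graph. -/
theorem reachable_and_dist_eq {V : Type*} {G : SimpleGraph V} {D : V → V → ℕ}
    (hself : ∀ u, D u u = 0) (hle : ∀ u v w, G.Adj v w → D u w ≤ D u v + 1)
    (hex : ∀ u v, u ≠ v → ∃ w, G.Adj w v ∧ D u w + 1 = D u v) (u v : V) :
    G.Reachable u v ∧ G.dist u v = D u v := by
  -- Descending along `hex` yields a walk of length `D u v`; by `hle`, no walk is shorter.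
  have h1 : ∀ n v, D u v = n → ∃ p : G.Walk u v, p.length = n := by
    intro n
    induction n with
    | zero =>
      intro v hv
      have : u = v := by
        by_contra hne
        obtain ⟨w, -, hw⟩ := hex u v hne
        omega
      subst this
      exact ⟨.nil, rfl⟩
    | succ n ih =>
      intro v hv
      have hne : u ≠ v := by
        rintro rfl
        rw [hself] at hv
        omega
      obtain ⟨w, hadj, hw⟩ := hex u v hne
      obtain ⟨p, hp⟩ := ih w (by omega)
      exact ⟨p.concat hadj, by rw [SimpleGraph.Walk.length_concat, hp]⟩
  have h2 : ∀ n v (p : G.Walk u v), p.length = n → D u v ≤ n := by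
    intro n
    induction n with
    | zero =>
      intro v p hp
      rw [← SimpleGraph.Walk.eq_of_length_eq_zero hp, hself]
    | succ n ih =>
      intro v p hp
      have hadj := p.adj_getVert_succ (i := n) (by omega)
      have hend : p.getVert (n + 1) = v := by rw [← hp, SimpleGraph.Walk.getVert_length]
      rw [hend] at hadj
      have := ih _ (p.take n) (by rw [SimpleGraph.Walk.take_length]; omega)
      have := hle u _ _ hadj
      omega
  obtain ⟨p, hp⟩ := h1 _ v rfl
  refine ⟨⟨p⟩, le_antisymm (hp ▸ G.dist_le p) ?_⟩
  obtain ⟨q, hq⟩ := (show G.Reachable u v from ⟨p⟩).exists_walk_length_eq_dist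
  exact h2 _ v q hq

section Starlike

variable {k : ℕ} {ℓ : Fin k → ℕ}

/-- The neighbour of a vertex on the way to the branching vertex. -/
def starlikeParent : (Σ i : Fin k, Fin (ℓ i)) → StarlikeVertex ℓ
  | ⟨_, ⟨0, _⟩⟩ => none
  | ⟨i, ⟨b + 1, h⟩⟩ => some ⟨i, ⟨b, by omega⟩⟩

/-- The distance in a starlike tree, see `dist_starlikeTree`. -/
def starlikeDist (ℓ : Fin k → ℕ) : StarlikeVertex ℓ → StarlikeVertex ℓ → ℕ
  | none, none => 0
  | none, some b => b.2.val + 1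
  | some a, none => a.2.val + 1
  | some a, some b => if a.1 = b.1 then Nat.dist a.2.val b.2.val else a.2.val + b.2.val + 2

theorem starlikeNext_some_iff (u : StarlikeVertex ℓ) (x : Σ i : Fin k, Fin (ℓ i)) :
    starlikeNext ℓ u (some x) ↔ u = starlikeParent x := by
  obtain ⟨i, ⟨b, hb⟩⟩ := x
  rcases u with _ | ⟨j, ⟨a, ha⟩⟩ <;> rcases b with _ | b
  · simp [starlikeNext, starlikeParent]
  · simp [starlikeNext, starlikeParent]
  · simp [starlikeNext, starlikeParent]
  · simp only [starlikeNext, starlikeParent, Option.some.injEq, Sigma.mk.injEq]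
    constructor
    · rintro ⟨rfl, h⟩
      obtain rfl : b = a := by omega
      simp
    · rintro ⟨rfl, h⟩
      simp only [heq_eq_eq, Fin.mk.injEq] at h
      exact ⟨rfl, by rw [h]⟩

theorem not_starlikeNext_none (u : StarlikeVertex ℓ) : ¬ starlikeNext ℓ u none := by
  cases u <;> simp [starlikeNext]

theorem starlikeNext_ne {u v : StarlikeVertex ℓ} (h : starlikeNext ℓ u v) : u ≠ v := by
  rintro rfl
  rcases u with _ | a <;> simp [starlikeNext] at h

theorem starlikeTree_adj {u v : StarlikeVertex ℓ} :
    (starlikeTree ℓ).Adj u v ↔ starlikeNext ℓ u v ∨ starlikeNext ℓ v u := by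
  rw [starlikeTree, SimpleGraph.fromRel_adj]
  exact ⟨fun h => h.2, fun h => ⟨h.elim starlikeNext_ne fun h => (starlikeNext_ne h).symm, h⟩⟩

theorem starlikeDist_le_of_adj (u v w : StarlikeVertex ℓ) (h : (starlikeTree ℓ).Adj v w) :
    starlikeDist ℓ u w ≤ starlikeDist ℓ u v + 1 := by
  rw [starlikeTree_adj] at h
  rcases u with _ | ⟨i, a⟩ <;> rcases v with _ | ⟨j, b⟩ <;> rcases w with _ | ⟨l, c⟩ <;>
    simp only [starlikeNext, starlikeDist, Nat.dist] at h ⊢ <;> (try split_ifs) <;> grind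

theorem exists_adj_starlikeDist (u v : StarlikeVertex ℓ) (h : u ≠ v) :
    ∃ w, (starlikeTree ℓ).Adj w v ∧ starlikeDist ℓ u w + 1 = starlikeDist ℓ u v := by
  rcases v with _ | ⟨j, ⟨b, hb⟩⟩
  · rcases u with _ | ⟨i, ⟨a, ha⟩⟩
    · exact absurd rfl h
    · refine ⟨some ⟨i, ⟨0, by omega⟩⟩, ?_, ?_⟩
      · simp [starlikeTree_adj, starlikeNext]
      · simp [starlikeDist, Nat.dist]
  · by_cases hu : ∃ a ha, u = some ⟨j, ⟨a, ha⟩⟩ ∧ b < a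
    · obtain ⟨a, ha, rfl, hlt⟩ := hu
      refine ⟨some ⟨j, ⟨b + 1, by omega⟩⟩, ?_, ?_⟩
      · simp [starlikeTree_adj, starlikeNext]
      · simp only [starlikeDist, Nat.dist, if_true]
        omega
    · refine ⟨starlikeParent ⟨j, ⟨b, hb⟩⟩,
        starlikeTree_adj.2 (.inl ((starlikeNext_some_iff _ _).2 rfl)), ?_⟩
      rcases u with _ | ⟨i, ⟨a, ha⟩⟩ <;> rcases b with _ | b
      · simp [starlikeDist, starlikeParent]
      · simp [starlikeDist, starlikeParent]
      · by_cases hij : i = j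
        · subst hij
          have : a ≠ 0 := by rintro rfl; exact h rfl
          exact absurd ⟨a, ha, rfl, by omega⟩ hu
        · simp [starlikeDist, starlikeParent, hij]
      · by_cases hij : i = j
        · subst hij
          have h1 : a ≠ b + 1 := by rintro rfl; exact h rfl
          have h2 : ¬ b + 1 < a := fun hlt => hu ⟨a, ha, rfl, hlt⟩
          simp only [starlikeDist, starlikeParent, Nat.dist, if_true]
          omega
        · simp [starlikeDist, starlikeParent, hij]
          omega

theorem starlikeDist_self (u : StarlikeVertex ℓ) : starlikeDist ℓ u u = 0 := by
  cases u <;> simp [starlikeDist, Nat.dist]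

theorem dist_starlikeTree (u v : StarlikeVertex ℓ) :
    (starlikeTree ℓ).dist u v = starlikeDist ℓ u v :=
  (reachable_and_dist_eq starlikeDist_self starlikeDist_le_of_adj exists_adj_starlikeDist u v).2

/-- Each edge joins a vertex other than the branching vertex to its parent, so there are few enough
edges for a connected graph to be a tree. -/
theorem isTree_starlikeTree (ℓ : Fin k → ℕ) : (starlikeTree ℓ).IsTree := by
  have hconn : (starlikeTree ℓ).Connected :=
    { preconnected := fun u v => (reachable_and_dist_eq starlikeDist_self starlikeDist_le_of_adj
        exists_adj_starlikeDist u v).1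
      nonempty := ⟨none⟩ }
  refine SimpleGraph.isTree_iff_connected_and_card.2 ⟨hconn, le_antisymm ?_
    hconn.card_vert_le_card_edgeSet_add_one⟩
  have hsub : (starlikeTree ℓ).edgeSet ⊆ Set.range fun x : Σ i : Fin k, Fin (ℓ i) =>
      s(some x, starlikeParent x) := by
    intro e
    induction e using Sym2.ind with
    | _ u v =>
      rw [SimpleGraph.mem_edgeSet, starlikeTree_adj]
      rintro (h | h)
      · rcases v with _ | x
        · exact absurd h (not_starlikeNext_none u)
        · exact ⟨x, by rw [(starlikeNext_some_iff _ _).1 h, Sym2.eq_swap]⟩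
      · rcases u with _ | x
        · exact absurd h (not_starlikeNext_none v)
        · exact ⟨x, by rw [(starlikeNext_some_iff _ _).1 h]⟩
  have h1 := Nat.card_mono (Set.finite_range _) hsub
  have h2 := Finite.card_range_le fun x : Σ i : Fin k, Fin (ℓ i) => s(some x, starlikeParent x)
  rw [Nat.card_eq_fintype_card (α := StarlikeVertex ℓ), Fintype.card_option,
    ← Nat.card_eq_fintype_card]
  exact Nat.add_le_add_right (h1.trans h2) 1

theorem card_starlikeVertex (ℓ : Fin k → ℕ) :
    Fintype.card (StarlikeVertex ℓ) = ∑ i, ℓ i + 1 := by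
  simp [StarlikeVertex]

theorem mem_pendentVertices {V : Type*} [Fintype V] {G : SimpleGraph V} {v : V} :
    v ∈ pendentVertices G ↔ ∃! w, G.Adj v w := by
  classical
  rw [pendentVertices, Finset.mem_filter, SimpleGraph.degree_eq_one_iff_existsUnique_adj]
  simp

theorem card_pendentVertices_starlikeTree (hk : 2 ≤ k) (hℓ : ∀ i, 1 ≤ ℓ i) :
    (pendentVertices (starlikeTree ℓ)).card = k := by
  classical
  let tip : Fin k → StarlikeVertex ℓ := fun i => some ⟨i, ⟨ℓ i - 1, by have := hℓ i; omega⟩⟩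
  have hinj : Function.Injective tip := by
    intro i j h
    simp only [tip, Option.some.injEq, Sigma.mk.injEq] at h
    exact h.1
  have : pendentVertices (starlikeTree ℓ) = Finset.univ.image tip := by
    ext v
    rw [mem_pendentVertices, Finset.mem_image]
    constructor
    · rintro ⟨w, -, hw⟩
      rcases v with _ | ⟨i, ⟨a, ha⟩⟩
      · have h0 := hw (some ⟨⟨0, by omega⟩, ⟨0, hℓ _⟩⟩) (by simp [starlikeTree_adj, starlikeNext])
        have h1 := hw (some ⟨⟨1, by omega⟩, ⟨0, hℓ _⟩⟩) (by simp [starlikeTree_adj, starlikeNext])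
        rw [← h0] at h1
        simp at h1
      · refine ⟨i, Finset.mem_univ i, ?_⟩
        by_cases h : a + 1 = ℓ i
        · simp only [tip, ← h, Nat.add_sub_cancel]
        · have h0 := hw (some ⟨i, ⟨a + 1, by omega⟩⟩) (by simp [starlikeTree_adj, starlikeNext])
          have h1 := hw (starlikeParent ⟨i, ⟨a, ha⟩⟩)
            (starlikeTree_adj.2 (.inr ((starlikeNext_some_iff _ _).2 rfl)))
          rw [← h0] at h1
          rcases a with _ | a <;> simp [starlikeParent] at h1
          omega
    · rintro ⟨i, -, rfl⟩
      refine ⟨starlikeParent _, starlikeTree_adj.2 (.inr ((starlikeNext_some_iff _ _).2 rfl)), ?_⟩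
      intro w hw
      rcases starlikeTree_adj.1 hw with h | h
      · rcases w with _ | ⟨j, ⟨a, ha⟩⟩
        · exact absurd h (not_starlikeNext_none _)
        · obtain ⟨rfl, h⟩ : i = j ∧ a = ℓ i - 1 + 1 := h
          have := hℓ i
          omega
      · exact (starlikeNext_some_iff _ _).1 h
  rw [this, Finset.card_image_of_injective _ hinj, Finset.card_univ, Fintype.card_fin]

theorem sum_inv_natDist_range (m : ℕ) :
    ∑ i ∈ Finset.range m, ∑ j ∈ Finset.range m, ((Nat.dist i j : ℕ) : ℝ)⁻¹ + 2 * harmonicSum m =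
      pathSum m := by
  rw [← sum_inv_natDist, Finset.sum_range_succ',
    Finset.sum_congr rfl fun i _ => Finset.sum_range_succ' _ m, Finset.sum_add_distrib,
    Finset.sum_range_succ']
  simp [Nat.dist, harmonicSum]
  ring

theorem two_mul_hararyIndex_starlikeTree (ℓ : Fin k → ℕ) :
    2 * hararyIndex (starlikeTree ℓ) = starlikeSum ℓ := by
  have hfin : ∀ (p q : ℕ) (F : ℕ → ℕ → ℝ), ∑ a : Fin p, ∑ b : Fin q, F a b =
      ∑ a ∈ Finset.range p, ∑ b ∈ Finset.range q, F a b := fun p q F => by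
    rw [Fin.sum_univ_eq_sum_range fun a => ∑ b : Fin q, F a b]
    exact Finset.sum_congr rfl fun a _ => Fin.sum_univ_eq_sum_range (F a) q
  -- A diagonal block lacks the branching vertex; the `2 * harmonicSum (ℓ i)` subtracted here
  -- returns with the row and column of that vertex.
  have hblock : ∀ i j : Fin k, ∑ a : Fin (ℓ i), ∑ b : Fin (ℓ j),
      ((if i = j then Nat.dist a b else (a : ℕ) + b + 2 : ℕ) : ℝ)⁻¹ = crossSum (ℓ i) (ℓ j) +
        if i = j then pathSum (ℓ i) - crossSum (ℓ i) (ℓ i) - 2 * harmonicSum (ℓ i) else 0 := by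
    intro i j
    split_ifs with h
    · subst h
      have := sum_inv_natDist_range (ℓ i)
      rw [hfin _ _ fun a b => ((Nat.dist a b : ℕ) : ℝ)⁻¹]
      linarith
    · rw [hfin _ _ fun a b => ((a + b + 2 : ℕ) : ℝ)⁻¹]
      simp [crossSum]
  have hdepth : ∀ i : Fin k, ∑ a : Fin (ℓ i), (((a : ℕ) + 1 : ℕ) : ℝ)⁻¹ = harmonicSum (ℓ i) := by
    intro i
    rw [Fin.sum_univ_eq_sum_range (fun a => ((a + 1 : ℕ) : ℝ)⁻¹)]
    simp [harmonicSum]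
  have hsum : ∑ u, ∑ v, (((starlikeTree ℓ).dist u v : ℕ) : ℝ)⁻¹ = starlikeSum ℓ := by
    simp only [dist_starlikeTree, Fintype.sum_option, Fintype.sum_sigma, Finset.sum_add_distrib,
      starlikeDist, hdepth]
    rw [Finset.sum_congr rfl fun i _ => Finset.sum_comm]
    simp only [hblock, Finset.sum_add_distrib, Finset.sum_ite_eq, Finset.mem_univ, if_true,
      starlikeSum, Finset.sum_sub_distrib, ← Finset.mul_sum]
    simp
    ring
  rw [hararyIndex, hsum]
  ring

end Starlike

/-! ### Betweenness, gates and convex sets in trees -/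

section Tree

variable {V : Type*} {T : SimpleGraph V}

/-- The vertex `v` lies on a shortest path from `a` to `b`. -/
def Between (T : SimpleGraph V) (a v b : V) : Prop := T.dist a v + T.dist v b = T.dist a b

theorem Between.symm {a v b : V} (h : Between T a v b) : Between T b v a := by
  unfold Between at *
  rw [T.dist_comm (u := b) (v := v), T.dist_comm (u := v) (v := a), T.dist_comm (u := b) (v := a)]
  omega

theorem between_left (a b : V) : Between T a a b := by simp [Between]

theorem between_right (a b : V) : Between T a b b := by simp [Between]

theorem between_of_mem_support {a b v : V} {p : T.Walk a b} (hc : T.Connected)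
    (hp : p.length = T.dist a b) (hv : v ∈ p.support) : Between T a v b := by
  classical
  have h1 := T.dist_le (p.takeUntil v hv)
  have h2 := T.dist_le (p.dropUntil v hv)
  have h3 := congrArg SimpleGraph.Walk.length (p.take_spec hv)
  rw [SimpleGraph.Walk.length_append] at h3
  have h4 := hc.dist_triangle (u := a) (v := v) (w := b)
  unfold Between
  omega

theorem exists_geodesic (hc : T.Connected) (g x : V) :
    ∃ γ : ℕ → V, γ 0 = g ∧ γ (T.dist g x) = x ∧
      ∀ i j, i ≤ j → j ≤ T.dist g x → T.dist (γ i) (γ j) = j - i := by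
  obtain ⟨p, hp⟩ := hc.exists_walk_length_eq_dist g x
  refine ⟨p.getVert, p.getVert_zero, by rw [← hp, p.getVert_length], fun i j hij hj => ?_⟩
  have h1 := T.dist_le (p.take i)
  have h2 := T.dist_le (p.drop j)
  have h3 := T.dist_le ((p.drop i).take (j - i))
  rw [SimpleGraph.Walk.take_length] at h1 h3
  rw [SimpleGraph.Walk.drop_getVert, Nat.add_sub_cancel' hij] at h3
  rw [SimpleGraph.Walk.drop_length] at h2
  have h4 := hc.dist_triangle (u := g) (v := p.getVert i) (w := x)
  have h5 := hc.dist_triangle (u := p.getVert i) (v := p.getVert j) (w := x)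
  omega

theorem exists_between_dist_eq (hc : T.Connected) {g x : V} {i : ℕ} (hi : i ≤ T.dist g x) :
    ∃ v, Between T g v x ∧ T.dist g v = i := by
  obtain ⟨γ, h0, h1, h⟩ := exists_geodesic hc g x
  have h2 := h 0 i (Nat.zero_le i) hi
  have h3 := h i _ hi le_rfl
  rw [h0] at h2
  rw [h1] at h3
  exact ⟨γ i, by unfold Between; omega, by omega⟩

/-- Shortest paths through `v` and through `v'` are both the unique path from `w` to `x`, read at
the same index. -/
theorem Between.eq_of_dist_eq (hT : T.IsTree) {w x v v' : V} (h : Between T w v x)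
    (h' : Between T w v' x) (hd : T.dist w v = T.dist w v') : v = v' := by
  have key : ∀ u, Between T w u x → ∃ r : T.Walk w x, r.IsPath ∧ r.getVert (T.dist w u) = u := by
    intro u hu
    obtain ⟨p, hp⟩ := hT.connected.exists_walk_length_eq_dist w u
    obtain ⟨q, hq⟩ := hT.connected.exists_walk_length_eq_dist u x
    refine ⟨p.append q, SimpleGraph.Walk.isPath_of_length_eq_dist _ ?_, ?_⟩
    · rw [SimpleGraph.Walk.length_append, hp, hq, hu]
    · rw [SimpleGraph.Walk.getVert_append, hp, if_neg (lt_irrefl _), Nat.sub_self,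
        SimpleGraph.Walk.getVert_zero]
  obtain ⟨r, hr, hv⟩ := key v h
  obtain ⟨r', hr', hv'⟩ := key v' h'
  rw [← hv, ← hv', hd, (hT.existsUnique_path w x).unique hr hr']

/-- Two shortest paths meeting only in `g` concatenate to a path, which is the unique one from `x`
to `y` and hence shortest. -/
theorem between_of_forall_eq (hT : T.IsTree) {x g y : V}
    (h : ∀ v, Between T x v g → Between T g v y → v = g) : Between T x g y := by
  have hc := hT.connected
  obtain ⟨p, hp⟩ := hc.exists_walk_length_eq_dist x g
  obtain ⟨q, hq⟩ := hc.exists_walk_length_eq_dist g y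
  obtain ⟨r, hr⟩ := hc.exists_walk_length_eq_dist x y
  have hpath : (p.append q).IsPath := by
    rw [SimpleGraph.Walk.isPath_def, SimpleGraph.Walk.support_append, List.nodup_append']
    have hqn := (q.isPath_of_length_eq_dist hq).support_nodup
    refine ⟨(p.isPath_of_length_eq_dist hp).support_nodup, hqn.tail, fun v hv hv' => ?_⟩
    obtain rfl := h v (between_of_mem_support hc hp hv)
      (between_of_mem_support hc hq (List.mem_of_mem_tail hv'))
    rw [← SimpleGraph.Walk.cons_tail_support] at hqn
    exact (List.nodup_cons.1 hqn).1 hv'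
  have := (hT.existsUnique_path x y).unique hpath (r.isPath_of_length_eq_dist hr)
  unfold Between
  rw [← hp, ← hq, ← hr, ← SimpleGraph.Walk.length_append, this]

/-- With two vertices, `S` contains the vertices between them. -/
def GeodesicallyConvex (T : SimpleGraph V) (S : Finset V) : Prop :=
  ∀ ⦃y⦄, y ∈ S → ∀ ⦃z⦄, z ∈ S → ∀ ⦃v⦄, Between T y v z → v ∈ S

/-- Every shortest path inside `S` can be prolonged to a vertex in `X`. -/
def SpannedBy (T : SimpleGraph V) (S X : Finset V) : Prop :=
  ∀ ⦃w⦄, w ∈ S → ∀ ⦃y⦄, y ∈ S → ∃ x ∈ X, Between T w y x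

/-- The gate is a vertex of `S` nearest to `x`. A vertex common to the ways from `g` to `y` and to
`x` lies in `S` by convexity and would be nearer unless it is `g`. -/
theorem exists_gate (hT : T.IsTree) {S : Finset V} (hS : GeodesicallyConvex T S)
    (hne : S.Nonempty) (x : V) : ∃ g ∈ S, ∀ y ∈ S, Between T y g x := by
  obtain ⟨g, hg, hmin⟩ := S.exists_min_image (fun y => T.dist y x) hne
  refine ⟨g, hg, fun y hy => between_of_forall_eq hT fun v h1 h2 => ?_⟩
  have := hmin v (hS hy hg h1)
  unfold Between at h2
  exact ((hT.connected.dist_eq_zero_iff).1 (by omega)).symm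

theorem GeodesicallyConvex.extend (hT : T.IsTree) {S S' : Finset V}
    (hS : GeodesicallyConvex T S) {g x : V} (hg : g ∈ S) (hgate : ∀ y ∈ S, Between T y g x)
    (hS' : ∀ v, v ∈ S' ↔ v ∈ S ∨ Between T g v x) : GeodesicallyConvex T S' := by
  have hc := hT.connected
  have mixed : ∀ y ∈ S, ∀ z, Between T g z x → ∀ v, Between T y v z → v ∈ S' := by
    intro y hy z hz v hv
    have hgx := hgate y hy
    have t1 := hc.dist_triangle (u := y) (v := g) (w := z)
    have t2 := hc.dist_triangle (u := y) (v := z) (w := x)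
    unfold Between at hz hv hgx
    -- The way from `y` to `z` runs through `g`; `v` is identified with the vertex `v'` at its
    -- distance from `y` on the part before or after `g`.
    rcases le_total (T.dist y v) (T.dist y g) with hle | hle
    · obtain ⟨v', hv', hd⟩ := exists_between_dist_eq hc hle
      have t3 := hc.dist_triangle (u := v') (v := g) (w := z)
      have t4 := hc.dist_triangle (u := y) (v := v') (w := z)
      have hv'' := hv'
      unfold Between at hv''
      have : v' = v := Between.eq_of_dist_eq hT (x := z) (by unfold Between; omega) hv hd
      exact (hS' v).2 (.inl (this ▸ hS hy hg hv'))
    · obtain ⟨v', hv', hd⟩ := exists_between_dist_eq hc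
        (show T.dist y v - T.dist y g ≤ T.dist g z by omega)
      have hv'' := hv'
      unfold Between at hv''
      have t3 := hc.dist_triangle (u := y) (v := g) (w := v')
      have t4 := hc.dist_triangle (u := y) (v := v') (w := z)
      have t5 := hc.dist_triangle (u := v') (v := z) (w := x)
      have t6 := hc.dist_triangle (u := g) (v := v') (w := x)
      have : v' = v := Between.eq_of_dist_eq hT (w := y) (x := z)
        (by unfold Between; omega) hv (by omega)
      exact (hS' v).2 (.inr (this ▸ by unfold Between; omega))
  have inner : ∀ y, Between T g y x → ∀ z, Between T g z x → T.dist g y ≤ T.dist g z →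
      ∀ v, Between T y v z → v ∈ S' := by
    intro y hy z hz hle v hv
    obtain ⟨y', hy', hd⟩ := exists_between_dist_eq hc hle
    have t1 := hc.dist_triangle (u := y') (v := z) (w := x)
    have t2 := hc.dist_triangle (u := g) (v := y') (w := x)
    unfold Between at hz hv
    have hy'' := hy'
    unfold Between at hy''
    obtain rfl : y' = y := Between.eq_of_dist_eq hT (x := x) (by unfold Between; omega) hy hd
    have t3 := hc.dist_triangle (u := g) (v := y') (w := v)
    have t4 := hc.dist_triangle (u := v) (v := z) (w := x)
    have t5 := hc.dist_triangle (u := g) (v := v) (w := x)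
    exact (hS' v).2 (.inr (by unfold Between; omega))
  intro y hy z hz v hv
  rcases (hS' y).1 hy with hy | hy <;> rcases (hS' z).1 hz with hz | hz
  · exact (hS' v).2 (.inl (hS hy hz hv))
  · exact mixed y hy z hz v hv
  · exact mixed z hz y hy v hv.symm
  · rcases le_total (T.dist g y) (T.dist g z) with hle | hle
    · exact inner y hy z hz hle v hv
    · exact inner z hz y hy hle v hv.symm

theorem SpannedBy.extend [DecidableEq V] (hT : T.IsTree) {S S' X : Finset V}
    (hS : SpannedBy T S X) (hXS : X ⊆ S) {g x : V} (hg : g ∈ S)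
    (hgate : ∀ y ∈ S, Between T y g x)
    (hS' : ∀ v, v ∈ S' ↔ v ∈ S ∨ Between T g v x) : SpannedBy T S' (insert x X) := by
  have hc := hT.connected
  have cross : ∀ y ∈ S, ∀ z, Between T g z x → Between T y g z := by
    intro y hy z hz
    have h := hgate y hy
    have t1 := hc.dist_triangle (u := y) (v := g) (w := z)
    have t2 := hc.dist_triangle (u := y) (v := z) (w := x)
    unfold Between at *
    omega
  intro w hw y hy
  rcases (hS' w).1 hw with hw | hw <;> rcases (hS' y).1 hy with hy | hy
  · obtain ⟨a, ha, h⟩ := hS hw hy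
    exact ⟨a, Finset.mem_insert_of_mem ha, h⟩
  · refine ⟨x, Finset.mem_insert_self x X, ?_⟩
    have h1 := cross w hw y hy
    have h2 := hgate w hw
    unfold Between at *
    omega
  · obtain ⟨a, ha, h⟩ := hS hg hy
    refine ⟨a, Finset.mem_insert_of_mem ha, ?_⟩
    have h1 := (cross a (hXS ha) w hw).symm
    have h2 := (cross y hy w hw).symm
    unfold Between at *
    omega
  · rcases le_total (T.dist g w) (T.dist g y) with hle | hle
    · refine ⟨x, Finset.mem_insert_self x X, ?_⟩
      obtain ⟨w', hw', hd⟩ := exists_between_dist_eq hc hle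
      have t1 := hc.dist_triangle (u := w') (v := y) (w := x)
      have t2 := hc.dist_triangle (u := g) (v := w') (w := x)
      unfold Between at hy hw'
      obtain rfl : w' = w := Between.eq_of_dist_eq hT (x := x) (by unfold Between; omega) hw hd
      unfold Between
      omega
    -- From the farther vertex `w`, the way through `y` leads back to `g` and on to any vertex in
    -- `X`.
    · obtain ⟨a, ha, -⟩ := hS hg hg
      refine ⟨a, Finset.mem_insert_of_mem ha, ?_⟩
      obtain ⟨y', hy', hd⟩ := exists_between_dist_eq hc hle
      have t1 := hc.dist_triangle (u := y') (v := w) (w := x)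
      have t2 := hc.dist_triangle (u := g) (v := y') (w := x)
      have h1 := cross a (hXS ha) w hw
      have h2 := cross a (hXS ha) y hy
      unfold Between at hw hy'
      obtain rfl : y' = y := Between.eq_of_dist_eq hT (x := x) (by unfold Between; omega) hy hd
      have t3 := hc.dist_triangle (u := a) (v := y') (w := w)
      refine Between.symm ?_
      unfold Between at *
      omega

/-- A sphere in `S` has at most as many vertices as `X`, and if a sphere of radius one has that many
vertices, then its centre separates the vertices in `X`. -/
theorem SpannedBy.card_sphere_le (hT : T.IsTree) {S X : Finset V} (hS : SpannedBy T S X)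
    {g : V} (hg : g ∈ S) (d : ℕ) (Y : Finset V) (hYS : Y ⊆ S) (hY : ∀ y ∈ Y, T.dist g y = d) :
    Y.card ≤ X.card ∧ (d = 1 → X.card ≤ Y.card → ∀ a ∈ X, ∀ b ∈ X, a ≠ b → Between T a g b) := by
  classical
  have hex : ∀ y, ∃ x, y ∈ Y → x ∈ X ∧ Between T g y x := by
    intro y
    by_cases hy : y ∈ Y
    · obtain ⟨x, hx, h⟩ := hS hg (hYS hy)
      exact ⟨x, fun _ => ⟨hx, h⟩⟩
    · exact ⟨y, fun h => absurd h hy⟩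
  choose F hF using hex
  have hinj : Set.InjOn F Y := by
    intro y hy z hz h
    exact Between.eq_of_dist_eq hT (hF y hy).2 (h ▸ (hF z hz).2) (by rw [hY y hy, hY z hz])
  refine ⟨Finset.card_le_card_of_injOn F (fun y hy => (hF y hy).1) hinj, fun hd hle => ?_⟩
  subst hd
  -- With a full sphere, each vertex in `X` is reached through its own neighbour of `g`.
  have himage : Y.image F = X := Finset.eq_of_subset_of_card_le
    (Finset.image_subset_iff.2 fun y hy => (hF y hy).1) (by rwa [Finset.card_image_of_injOn hinj])
  intro a ha b hb hab
  rw [← himage, Finset.mem_image] at ha hb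
  obtain ⟨y, hy, rfl⟩ := ha
  obtain ⟨z, hz, rfl⟩ := hb
  refine between_of_forall_eq hT fun v hv hv' => ?_
  by_contra hne
  have hpos := hT.connected.pos_dist_of_ne (Ne.symm hne)
  -- The neighbour of `g` towards a second common vertex `v` would equal both `y` and `z`.
  obtain ⟨u, hu, hu1⟩ := exists_between_dist_eq hT.connected (g := g) (x := v) (i := 1) hpos
  have extend : ∀ c, Between T g v c → Between T g u c := by
    intro c h
    have t1 := hT.connected.dist_triangle (u := u) (v := v) (w := c)
    have t2 := hT.connected.dist_triangle (u := g) (v := u) (w := c)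
    unfold Between at *
    omega
  have h1 : u = y := (extend _ hv.symm).eq_of_dist_eq hT (hF y hy).2 (by rw [hu1, hY y hy])
  have h2 : u = z := (extend _ hv').eq_of_dist_eq hT (hF z hz).2 (by rw [hu1, hY z hz])
  exact hab (by rw [← h1, ← h2])

/-! ### Attaching a shortest path to a convex set -/

/-- The sum of the reciprocal distances over the ordered pairs of vertices in `S`. -/
noncomputable def reciprocalSum (T : SimpleGraph V) (S : Finset V) : ℝ :=
  ∑ u ∈ S, ∑ v ∈ S, ((T.dist u v : ℕ) : ℝ)⁻¹

theorem reciprocalSum_disjUnion {S N : Finset V} (h : Disjoint S N) :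
    reciprocalSum T (S.disjUnion N h) = reciprocalSum T S +
      2 * ∑ y ∈ S, ∑ z ∈ N, ((T.dist y z : ℕ) : ℝ)⁻¹ + reciprocalSum T N := by
  have : ∑ u ∈ N, ∑ v ∈ S, ((T.dist u v : ℕ) : ℝ)⁻¹ =
      ∑ u ∈ S, ∑ v ∈ N, ((T.dist u v : ℕ) : ℝ)⁻¹ := by
    rw [Finset.sum_comm]
    simp only [T.dist_comm]
  simp only [reciprocalSum, Finset.sum_disjUnion, Finset.sum_add_distrib, this]
  ring

/-- Lists the vertices of the balanced tree by depth, to match the bound in `sum_le_sum_range_div`.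
-/
theorem crossSum_balancedLengths (h : ℕ) {j : ℕ} (hj : 0 < j) (N : ℕ) :
    ∑ i, crossSum h (balancedLengths (N + 1) j i) =
      ∑ m ∈ Finset.range N, ∑ a ∈ Finset.range h, ((a : ℝ) + (m / j + 1 : ℕ) + 1)⁻¹ := by
  rw [← sum_balancedLengths (fun d => ∑ a ∈ Finset.range h, ((a : ℝ) + (d : ℕ) + 1)⁻¹) hj]
  refine Finset.sum_congr rfl fun i _ => ?_
  rw [crossSum, Finset.sum_comm]
  refine Finset.sum_congr rfl fun b _ => Finset.sum_congr rfl fun a _ => ?_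
  push_cast
  ring

/-- Prolonging the convex set `S` by the shortest path to a vertex `x`. -/
theorem exists_extension (hT : T.IsTree) {S X : Finset V} (hconv : GeodesicallyConvex T S)
    (hspan : SpannedBy T S X) (hXS : X ⊆ S) (hX : X.Nonempty) [DecidableEq V] (x : V) :
    ∃ (S' : Finset V) (h : ℕ), insert x X ⊆ S' ∧ GeodesicallyConvex T S' ∧
      SpannedBy T S' (insert x X) ∧ S'.card = S.card + h ∧
      (reciprocalSum T S ≤ starlikeSum (balancedLengths S.card X.card) →
        reciprocalSum T S' ≤
          starlikeSum (Fin.cons h (balancedLengths S.card X.card) : Fin (X.card + 1) → ℕ) ∧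
        (reciprocalSum T S' =
            starlikeSum (Fin.cons h (balancedLengths S.card X.card) : Fin (X.card + 1) → ℕ) →
          0 < h → X.card < S.card →
          ∃ g, ∀ a ∈ insert x X, ∀ b ∈ insert x X, a ≠ b → Between T a g b)) := by
  have hc := hT.connected
  obtain ⟨g, hg, hgate⟩ := exists_gate hT hconv (hX.mono hXS) x
  obtain ⟨γ, h0, hend, hγ⟩ := exists_geodesic hc g x
  set h := T.dist g x with hh
  have hγ' : ∀ i j, i ≤ h → j ≤ h → T.dist (γ i) (γ j) = Nat.dist i j := by
    intro i j hi hj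
    rw [Nat.dist]
    rcases le_total i j with hij | hij
    · rw [hγ i j hij hj]
      omega
    · rw [T.dist_comm, hγ j i hij hi]
      omega
  have hbtw : ∀ i ≤ h, Between T g (γ i) x ∧ T.dist g (γ i) = i := by
    intro i hi
    have h1 := hγ 0 i (Nat.zero_le i) hi
    have h2 := hγ i h hi le_rfl
    rw [h0] at h1
    rw [hend] at h2
    exact ⟨by unfold Between; omega, by omega⟩
  have hcross : ∀ y ∈ S, ∀ i ≤ h, T.dist y (γ i) = T.dist g y + i := by
    intro y hy i hi
    obtain ⟨h1, h2⟩ := hbtw i hi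
    have h3 := hgate y hy
    have t1 := hc.dist_triangle (u := y) (v := g) (w := γ i)
    have t2 := hc.dist_triangle (u := y) (v := γ i) (w := x)
    rw [T.dist_comm (u := g) (v := y)]
    unfold Between at h1 h3
    omega
  -- The shift leaves out `γ 0 = g`, which is already in `S`.
  set N := (Finset.range h).image fun i => γ (i + 1) with hN
  have hinj : Set.InjOn (fun i => γ (i + 1)) (Finset.range h : Set ℕ) := by
    intro i hi j hj hij
    rw [Finset.mem_coe, Finset.mem_range] at hi hj
    have h1 := (hbtw (i + 1) hi).2
    have h2 := (hbtw (j + 1) hj).2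
    simp only at hij
    rw [hij] at h1
    omega
  have hdisj : Disjoint S N := by
    rw [Finset.disjoint_right]
    intro z hz hzS
    obtain ⟨i, hi, rfl⟩ := Finset.mem_image.1 hz
    have := hcross _ hzS (i + 1) (Finset.mem_range.1 hi)
    simp at this
  have hmem : ∀ v, v ∈ S.disjUnion N hdisj ↔ v ∈ S ∨ Between T g v x := by
    intro v
    rw [Finset.mem_disjUnion, hN, Finset.mem_image]
    constructor
    · rintro (hv | ⟨i, hi, rfl⟩)
      · exact .inl hv
      · exact .inr (hbtw _ (Finset.mem_range.1 hi)).1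
    · rintro (hv | hv)
      · exact .inl hv
      · have hle : T.dist g v ≤ h := by
          unfold Between at hv
          omega
        have heq : γ (T.dist g v) = v := (hbtw _ hle).1.eq_of_dist_eq hT hv (hbtw _ hle).2
        rcases Nat.eq_zero_or_pos (T.dist g v) with hz | hz
        · rw [hz, h0] at heq
          exact .inl (heq ▸ hg)
        · refine .inr ⟨T.dist g v - 1, Finset.mem_range.2 (by omega), ?_⟩
          rw [Nat.sub_add_cancel hz, heq]
  refine ⟨S.disjUnion N hdisj, h, ?_, hconv.extend hT hg hgate hmem,
    hspan.extend hT hXS hg hgate hmem, ?_, fun hle => ?_⟩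
  · intro v hv
    rcases Finset.mem_insert.1 hv with rfl | hv
    · exact (hmem v).2 (.inr (between_right g v))
    · exact (hmem v).2 (.inl (hXS hv))
  · rw [Finset.card_disjUnion, hN, Finset.card_image_of_injOn hinj, Finset.card_range]
  obtain ⟨M, hM⟩ := Nat.exists_eq_succ_of_ne_zero (Finset.card_pos.2 ⟨g, hg⟩).ne'
  have hcardM : (S.erase g).card = M := by rw [Finset.card_erase_of_mem hg, hM]; rfl
  let f : ℕ → ℝ := fun d => ∑ a ∈ Finset.range h, ((a : ℝ) + d + 1)⁻¹
  have hsum : reciprocalSum T (S.disjUnion N hdisj) =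
      reciprocalSum T S + pathSum h + 2 * ∑ y ∈ S.erase g, f (T.dist g y) := by
    have hNN : reciprocalSum T N = ∑ i ∈ Finset.range h, ∑ j ∈ Finset.range h,
        ((Nat.dist i j : ℕ) : ℝ)⁻¹ := by
      rw [reciprocalSum, hN, Finset.sum_image hinj]
      refine Finset.sum_congr rfl fun i hi => ?_
      rw [Finset.sum_image hinj]
      refine Finset.sum_congr rfl fun j hj => ?_
      rw [hγ' _ _ (Finset.mem_range.1 hi) (Finset.mem_range.1 hj), Nat.dist_succ_succ]
    have hSN : ∀ y ∈ S, ∑ z ∈ N, ((T.dist y z : ℕ) : ℝ)⁻¹ = f (T.dist g y) := by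
      intro y hy
      rw [hN, Finset.sum_image hinj]
      refine Finset.sum_congr rfl fun i hi => ?_
      rw [hcross y hy _ (Finset.mem_range.1 hi)]
      push_cast
      ring
    -- Together with the terms of `g`, the new vertices form a path with `h` edges.
    have hf0 : f (T.dist g g) = harmonicSum h := by simp [f, harmonicSum]
    rw [reciprocalSum_disjUnion, hNN, Finset.sum_congr rfl hSN, ← Finset.add_sum_erase _ _ hg, hf0,
      ← sum_inv_natDist_range]
    ring
  have hstar : starlikeSum (Fin.cons h (balancedLengths S.card X.card) : Fin (X.card + 1) → ℕ) =
      starlikeSum (balancedLengths S.card X.card) + pathSum h +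
        2 * ∑ m ∈ Finset.range M, f (m / X.card + 1) := by
    rw [starlikeSum_cons, hM, crossSum_balancedLengths h hX.card_pos]
    ring
  have hterm : ∀ {d e : ℕ}, d < e → ∀ a ∈ Finset.range h,
      ((a : ℝ) + e + 1)⁻¹ < ((a : ℝ) + d + 1)⁻¹ := by
    intro d e hde a _
    have : (d : ℝ) < e := by exact_mod_cast hde
    gcongr
  have hanti : Antitone f := antitone_iff_forall_lt.2 fun d e hde =>
    Finset.sum_le_sum fun a ha => (hterm hde a ha).le
  have hsphere := fun d => hspan.card_sphere_le hT hg d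
    ((S.erase g).filter fun y => T.dist g y = d)
    ((Finset.filter_subset _ _).trans (Finset.erase_subset _ _))
    fun y hy => (Finset.mem_filter.1 hy).2
  obtain ⟨hgreedy, hstrict⟩ := sum_le_sum_range_div (T.dist g) hanti (S.erase g)
    (fun y hy => hc.pos_dist_of_ne (Finset.ne_of_mem_erase hy).symm) fun d _ => (hsphere d).1
  rw [hcardM] at hgreedy hstrict
  rw [hsum, hstar]
  refine ⟨by linarith, fun heq hpos hlt => ⟨g, ?_⟩⟩
  -- A smaller sphere of radius one would make the greedy comparison strict, as `f` is strictly
  -- decreasing for `0 < h`.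
  have hsep := (hsphere 1).2 rfl <| by
    by_contra! hlt'
    have := hstrict (fun d e hde => Finset.sum_lt_sum_of_nonempty
      (Finset.nonempty_range_iff.2 hpos.ne') (hterm hde)) (by omega) hlt'
    linarith
  intro a ha b hb hab
  rcases Finset.mem_insert.1 ha with rfl | haX <;> rcases Finset.mem_insert.1 hb with rfl | hbX
  · exact absurd rfl hab
  · exact (hgate b (hXS hbX)).symm
  · exact hgate a (hXS haX)
  · exact hsep a haX b hbX hab

theorem sum_cons_balancedLengths (h : ℕ) {N j : ℕ} (hj : 0 < j) (hN : 0 < N) :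
    ∑ i, (Fin.cons h (balancedLengths N j) : Fin (j + 1) → ℕ) i =
      ∑ i, balancedLengths (N + h) (j + 1) i := by
  have h1 := balancedLengths_sum N j hj hN
  have h2 := balancedLengths_sum (N + h) (j + 1) (Nat.succ_pos j) (by omega)
  rw [Fin.sum_univ_succ]
  simp only [Fin.cons_zero, Fin.cons_succ]
  omega

/-- Each new vertex of `X` attaches a path to a set bounded by a balanced tree, and balancing again
restores the form of the bound. -/
theorem exists_convex_spannedBy (hT : T.IsTree) {X : Finset V} (hX : X.Nonempty) :
    ∃ S, X ⊆ S ∧ GeodesicallyConvex T S ∧ SpannedBy T S X ∧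
      reciprocalSum T S ≤ starlikeSum (balancedLengths S.card X.card) := by
  classical
  induction hX using Finset.Nonempty.cons_induction with
  | singleton a =>
    refine ⟨{a}, subset_rfl, ?_, ?_, ?_⟩
    · intro y hy z hz v hv
      rw [Finset.mem_singleton] at *
      subst hy hz
      unfold Between at hv
      rw [T.dist_self] at hv
      exact ((hT.connected.dist_eq_zero_iff).1 (by omega)).symm
    · intro w hw y hy
      rw [Finset.mem_singleton] at hw hy
      exact ⟨a, Finset.mem_singleton_self a, by rw [hw, hy]; exact between_left a a⟩
    · simp [reciprocalSum, starlikeSum, balancedLengths, pathSum]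
  | cons x X hx hX ih =>
    obtain ⟨S, hXS, hconv, hspan, hle⟩ := ih
    obtain ⟨S', h, hsub, hconv', hspan', hcard, hbound⟩ :=
      exists_extension hT hconv hspan hXS hX x
    rw [Finset.cons_eq_insert]
    refine ⟨S', hsub, hconv', hspan', (hbound hle).1.trans ?_⟩
    rw [Finset.card_insert_of_notMem hx, hcard]
    exact starlikeSum_le_of_le_succ (balancedLengths_le_succ _ _) _
      (sum_cons_balancedLengths h hX.card_pos (hX.mono hXS).card_pos)

theorem dist_map_le {W : Type*} {G : SimpleGraph V} {G' : SimpleGraph W} (f : G →g G') {u v : V}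
    (h : G.Reachable u v) : G'.dist (f u) (f v) ≤ G.dist u v := by
  obtain ⟨p, hp⟩ := h.exists_walk_length_eq_dist
  rw [← hp, ← p.length_map f]
  exact G'.dist_le _

/-! ### Pendent vertices and recognition of starlike trees -/

section Pendent

variable [Fintype V]

/-- Among the vertices beyond `y`, one farthest from `w` has only neighbours nearer to `w`, and in a
tree there is at most one of these. -/
theorem exists_pendent_between (hT : T.IsTree) [Nontrivial V] (w y : V) :
    ∃ x ∈ pendentVertices T, Between T w y x := by
  classical
  have hc := hT.connected
  obtain ⟨x, hx, hmax⟩ := (Finset.univ.filter fun x => Between T w y x).exists_max_image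
    (T.dist w) ⟨y, by simpa using between_right w y⟩
  rw [Finset.mem_filter] at hx
  have hmax' : ∀ z, Between T w y z → T.dist w z ≤ T.dist w x := fun z hz =>
    hmax z (by simpa using hz)
  have hadj : ∀ z, T.Adj x z → T.dist w z + 1 = T.dist w x := by
    intro z hz
    have h1 := SimpleGraph.dist_eq_one_iff_adj.2 hz
    rcases hT.dist_eq_dist_add_one_of_adj w hz with h | h
    · exact h.symm
    · have hb : Between T w y z := by
        have h2 := hx.2
        have t1 := hc.dist_triangle (u := y) (v := x) (w := z)
        have t2 := hc.dist_triangle (u := w) (v := y) (w := z)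
        unfold Between at *
        omega
      have := hmax' z hb
      omega
  refine ⟨x, mem_pendentVertices.2 ?_, hx.2⟩
  obtain ⟨z, hz⟩ := hc.preconnected.exists_adj_of_nontrivial x
  refine ⟨z, hz, fun z' hz' => ?_⟩
  have h1 := hadj z hz
  have h2 := hadj z' hz'
  have h3 := SimpleGraph.dist_eq_one_iff_adj.2 hz.symm
  have h4 := SimpleGraph.dist_eq_one_iff_adj.2 hz'.symm
  exact Between.eq_of_dist_eq hT (w := w) (x := x) (by unfold Between; omega)
    (by unfold Between; omega) (by omega)

/-- A tree in which `g` separates the pendent vertices is starlike. -/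
theorem nonempty_iso_starlikeTree (hT : T.IsTree) [Nontrivial V] {k : ℕ}
    (e : Fin k ≃ {x // x ∈ pendentVertices T}) {g : V}
    (hg : ∀ i j, i ≠ j → Between T (e i : V) g (e j)) {ℓ : Fin k → ℕ}
    (hℓ : ∀ i, ℓ i = T.dist g (e i)) : Nonempty (T ≃g starlikeTree ℓ) := by
  have hc := hT.connected
  choose γ h0 hend hγ using fun i => exists_geodesic hc g (e i : V)
  let φ : StarlikeVertex ℓ → V := fun u => u.elim g fun x => γ x.1 (x.2 + 1)
  have hpt : ∀ i a, a < ℓ i → T.dist g (γ i (a + 1)) = a + 1 ∧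
      T.dist (γ i (a + 1)) (e i) + (a + 1) = ℓ i := by
    intro i a ha
    rw [hℓ] at ha
    have h1 := hγ i 0 (a + 1) (Nat.zero_le _) ha
    have h2 := hγ i (a + 1) _ ha le_rfl
    rw [h0] at h1
    rw [hend] at h2
    have := hℓ i
    omega
  have hdist : ∀ u v, T.dist (φ u) (φ v) = starlikeDist ℓ u v := by
    rintro (_ | ⟨i, ⟨a, ha⟩⟩) (_ | ⟨j, ⟨b, hb⟩⟩)
    · exact T.dist_self
    · exact (hpt j b hb).1
    · exact T.dist_comm.trans (hpt i a ha).1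
    · change T.dist (γ i (a + 1)) (γ j (b + 1)) = if i = j then Nat.dist a b else a + b + 2
      split_ifs with hij
      · subst hij
        have h1 := hγ i (a + 1) (b + 1)
        have h2 := hγ i (b + 1) (a + 1)
        rw [← hℓ] at h1 h2
        rw [Nat.dist]
        rcases le_total a b with hab | hab
        · rw [h1 (by omega) (by omega)]
          omega
        · rw [T.dist_comm, h2 (by omega) (by omega)]
          omega
      · obtain ⟨h1, h2⟩ := hpt i a ha
        obtain ⟨h3, h4⟩ := hpt j b hb
        have h5 := hg i j hij
        have h6 := hℓ i
        have h7 := hℓ j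
        unfold Between at h5
        rw [T.dist_comm (v := g)] at h5
        -- The detour through `g` bounds the distance from above; were it smaller, the ends `e i`
        -- and `e j` would be closer than `ℓ i + ℓ j`.
        have t1 := hc.dist_triangle (u := γ i (a + 1)) (v := g) (w := γ j (b + 1))
        have t2 := hc.dist_triangle (u := (e i : V)) (v := γ i (a + 1)) (w := e j)
        have t3 := hc.dist_triangle (u := γ i (a + 1)) (v := γ j (b + 1)) (w := e j)
        rw [T.dist_comm (v := g)] at t1
        rw [T.dist_comm (v := γ i (a + 1))] at t2
        omega
  have hinj : Function.Injective φ := by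
    intro u v h
    have h1 := hdist u v
    rw [h, T.dist_self, ← dist_starlikeTree] at h1
    exact ((isTree_starlikeTree ℓ).connected.dist_eq_zero_iff).1 h1.symm
  have hsurj : Function.Surjective φ := by
    intro v
    obtain ⟨x, hx, hv⟩ := exists_pendent_between hT g v
    obtain ⟨i, hi⟩ := e.surjective ⟨x, hx⟩
    obtain rfl : (e i : V) = x := congrArg Subtype.val hi
    rcases Nat.eq_zero_or_pos (T.dist g v) with hz | hz
    · exact ⟨none, (hc.dist_eq_zero_iff).1 hz⟩
    · obtain ⟨a, ha⟩ := Nat.exists_eq_succ_of_ne_zero hz.ne'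
      have hv' := hv
      unfold Between at hv'
      have hlt : a < ℓ i := by
        rw [hℓ]
        omega
      refine ⟨some ⟨i, ⟨a, hlt⟩⟩, ?_⟩
      obtain ⟨h1, h2⟩ := hpt i a hlt
      have h3 := hℓ i
      exact Between.eq_of_dist_eq hT (x := e i)
        (by unfold Between; simp only [φ, Option.elim]; omega) hv (by simp only [φ, Option.elim]; omega)
  exact ⟨SimpleGraph.Iso.symm ⟨Equiv.ofBijective φ ⟨hinj, hsurj⟩, fun {u v} => by
    rw [← SimpleGraph.dist_eq_one_iff_adj, ← SimpleGraph.dist_eq_one_iff_adj, dist_starlikeTree,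
      ← hdist]
    rfl⟩⟩

theorem hararyIndex_eq_of_iso {W : Type*} [Fintype W] {G : SimpleGraph V} {G' : SimpleGraph W}
    (hG : G.Connected) (f : G ≃g G') : hararyIndex G = hararyIndex G' := by
  have hdist : ∀ u v, G'.dist (f u) (f v) = G.dist u v := by
    intro u v
    have hr := hG.preconnected u v
    refine le_antisymm (dist_map_le f.toHom hr) ?_
    have := dist_map_le f.symm.toHom (hr.map f.toHom)
    simpa using this
  unfold hararyIndex
  rw [← Equiv.sum_comp f.toEquiv]
  refine congrArg (· / 2) (Finset.sum_congr rfl fun u _ => ?_)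
  rw [← Equiv.sum_comp f.toEquiv]
  exact Finset.sum_congr rfl fun v _ => congrArg (fun d : ℕ => (d : ℝ)⁻¹) (hdist u v).symm

theorem two_mul_hararyIndex (T : SimpleGraph V) :
    2 * hararyIndex T = reciprocalSum T Finset.univ := by
  rw [hararyIndex, reciprocalSum]
  ring

/-! ### The extremal theorem -/

/-- The balanced starlike tree maximizes the Harary index, and a tree with the same index is
isomorphic to it. -/
theorem hararyIndex_le_balancedStarlikeTree (hT : T.IsTree) {k : ℕ} (hk : 3 ≤ k)
    (hn : k < Fintype.card V) (hcard : (pendentVertices T).card = k) :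
    hararyIndex T ≤ hararyIndex (balancedStarlikeTree (Fintype.card V) k) ∧
    (hararyIndex T = hararyIndex (balancedStarlikeTree (Fintype.card V) k) →
      Nonempty (T ≃g balancedStarlikeTree (Fintype.card V) k)) := by
  classical
  have : Nontrivial V := Fintype.one_lt_card_iff_nontrivial.1 (by omega)
  obtain ⟨x, X, hx, hX, hXk⟩ : ∃ x X, x ∉ X ∧ insert x X = pendentVertices T ∧ X.card + 1 = k := by
    obtain ⟨x, hx⟩ := Finset.card_pos.1 (show 0 < (pendentVertices T).card by omega)
    exact ⟨x, (pendentVertices T).erase x, Finset.notMem_erase _ _, Finset.insert_erase hx,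
      by rw [Finset.card_erase_of_mem hx]; omega⟩
  subst hXk
  have hXpos : 0 < X.card := by omega
  obtain ⟨S, hXS, hconv, hspan, hle⟩ := exists_convex_spannedBy hT (Finset.card_pos.1 hXpos)
  obtain ⟨S', h, hsub, hconv', -, hcard', hbound⟩ :=
    exists_extension hT hconv hspan hXS (Finset.card_pos.1 hXpos) x
  obtain ⟨hle', heq'⟩ := hbound hle
  rw [hX] at hsub heq'
  -- Every vertex lies between two pendent vertices, all of which are in the convex set `S'`.
  obtain rfl : S' = Finset.univ := Finset.eq_univ_of_forall fun v => by
    obtain ⟨w, hw, -⟩ := exists_pendent_between hT v v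
    obtain ⟨z, hz, hv⟩ := exists_pendent_between hT w v
    exact hconv' (hsub hw) (hsub hz) hv
  rw [Finset.card_univ] at hcard'
  have hSpos : 0 < S.card := hXpos.trans_le (Finset.card_le_card hXS)
  have hbal := balancedLengths_le_succ (Fintype.card V) (X.card + 1)
  have hbalsum := balancedLengths_sum (Fintype.card V) (X.card + 1) (by omega) (by omega)
  have hsum := sum_cons_balancedLengths h hXpos hSpos
  rw [← hcard'] at hsum
  have hsmooth := starlikeSum_le_of_le_succ hbal _ hsum
  have hB := two_mul_hararyIndex_starlikeTree (balancedLengths (Fintype.card V) (X.card + 1))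
  have hH := two_mul_hararyIndex T
  rw [← balancedStarlikeTree] at hB
  refine ⟨by linarith, fun heq => ?_⟩
  have hdiff := le_succ_of_starlikeSum_eq hk hbal hsum (by omega) (by linarith)
  have hdiff0 := fun i : Fin X.card => hdiff i.succ 0
  -- With an empty path all orders would be at most one, and their sum would be less than the number
  -- of paths.
  have hcons : ∀ i, 0 < (Fin.cons h (balancedLengths S.card X.card) : Fin (X.card + 1) → ℕ) i := by
    intro i
    by_contra! hi
    have : ∑ r, (Fin.cons h (balancedLengths S.card X.card) : Fin (X.card + 1) → ℕ) r <
        ∑ r : Fin (X.card + 1), 1 :=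
      Finset.sum_lt_sum (fun r _ => by have := hdiff r i; omega) ⟨i, Finset.mem_univ i, by omega⟩
    simp only [Finset.sum_const, Finset.card_univ, Fintype.card_fin, smul_eq_mul, mul_one] at this
    omega
  have hSX : X.card < S.card := by
    have h1 := balancedLengths_sum S.card X.card hXpos hSpos
    have h2 : ∑ i : Fin X.card, 1 ≤ ∑ i, balancedLengths S.card X.card i :=
      Finset.sum_le_sum fun i _ => hcons i.succ
    simp only [Finset.sum_const, Finset.card_univ, Fintype.card_fin, smul_eq_mul, mul_one] at h2
    omega
  obtain ⟨g, hg⟩ := heq' (by linarith) (hcons 0) hSX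
  let e : Fin (X.card + 1) ≃ {x // x ∈ pendentVertices T} :=
    ((pendentVertices T).equivFinOfCardEq hcard).symm
  have hsep : ∀ e : Fin (X.card + 1) ≃ {x // x ∈ pendentVertices T}, ∀ i j, i ≠ j →
      Between T (e i : V) g (e j) := fun e i j hij =>
    hg _ (e i).2 _ (e j).2 fun h => hij (e.injective (Subtype.ext h))
  obtain ⟨iso⟩ := nonempty_iso_starlikeTree hT e (hsep e) (ℓ := fun i => T.dist g (e i))
    fun i => rfl
  -- `T` is now starlike with orders `T.dist g (e i)`, so the equality case of balancing applies a
  -- second time, to these.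
  have h1 := two_mul_hararyIndex_starlikeTree fun i => T.dist g (e i)
  rw [← hararyIndex_eq_of_iso hT.connected iso, heq, hB] at h1
  have h2 := Fintype.card_congr iso.toEquiv
  rw [card_starlikeVertex] at h2
  have h3 := le_succ_of_starlikeSum_eq hk hbal (ℓ := fun i => T.dist g (e i)) (by omega) (by omega)
    h1.symm
  obtain ⟨σ, hσ⟩ := exists_perm_of_le_succ hbal h3 (by omega)
  exact nonempty_iso_starlikeTree hT (σ.trans e) (hsep _) fun i => (hσ i).symm

end Pendent

end Tree

end Harary

/-- Among the trees on `n` vertices with `k` pendent vertices, `3 ≤ k ≤ n - 2`, the balanced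
starlike tree is, up to isomorphism, the unique one with maximal Harary index. The first three
conjuncts say that it belongs to this class. -/
theorem theorem3p1 (n k : ℕ) (hk : 3 ≤ k) (hkn : k + 2 ≤ n) :
    (Harary.balancedStarlikeTree n k).IsTree ∧
    Fintype.card (Harary.StarlikeVertex (Harary.balancedLengths n k)) = n ∧
    (Harary.pendentVertices (Harary.balancedStarlikeTree n k)).card = k ∧
    ∀ (V : Type*) [Fintype V] (T : SimpleGraph V), T.IsTree → Fintype.card V = n →
      (Harary.pendentVertices T).card = k →
      Harary.hararyIndex T ≤ Harary.hararyIndex (Harary.balancedStarlikeTree n k) ∧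
      (Harary.hararyIndex T = Harary.hararyIndex (Harary.balancedStarlikeTree n k) ↔
        Nonempty (T ≃g Harary.balancedStarlikeTree n k)) := by
  refine ⟨Harary.isTree_starlikeTree _, ?_, ?_, ?_⟩
  · rw [Harary.card_starlikeVertex, Harary.balancedLengths_sum n k (by omega) (by omega)]
  · exact Harary.card_pendentVertices_starlikeTree (by omega)
      (Harary.balancedLengths_pos n k (by omega))
  · rintro V _ T hT rfl hcard
    obtain ⟨hle, hiso⟩ := Harary.hararyIndex_le_balancedStarlikeTree hT hk (by omega) hcard
    exact ⟨hle, hiso, fun ⟨f⟩ => Harary.hararyIndex_eq_of_iso hT.connected f⟩
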